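/- All graphs are finite, undirected and simple. For a graph $G$ and a positive integer $k$, let $h(G,k)$ be the least number of edges whose deletion from $G$ leaves a $k$-colorable graph. For a family $\mathcal{H}$ of graphs, let $h(n,k,\mathcal{H})$ be the maximum of $h(G,k)$ over all $n$-vertex graphs $G$ that contain no member of $\mathcal{H}$ as a (not necessarily induced) subgraph, and write $h(n,k,H)=h(n,k,\{H\})$. Let $C_\ell$ be the cycle of length $\ell$ and, for a positive integer $r$, let $\mathcal{H}_r=\{C_3,C_5,\ldots,C_{2r+1}\}$ be the family of odd cycles of length at most $2r+1$. Theorem. For every integer $r\ge 1$ there is a constant $c_r>0$, depending only on $r$, such that for all integers $n\ge k\ge 1$, $$\bigl|h(n,k,C_{2r+1})-h(n,k,\mathcal{H}_r)\bigr|\le c_r\,n^{3/2}$$ and $$h(n,k,C_{2r+1})\le c_r\,\frac{n^2}{k^{r+1}}.$$ -/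

import Mathlib

namespace EdgeDeletion

/-- The numbers of edges that can be deleted from `G` so that the rest is `k`-colorable. -/
def deletionSizes {V : Type*} (G : SimpleGraph V) (k : ℕ) : Set ℕ :=
  {m | ∃ s : Finset (Sym2 V), (s : Set (Sym2 V)) ⊆ G.edgeSet ∧
    (G.deleteEdges (s : Set (Sym2 V))).Colorable k ∧ s.card = m}

/-- `h(G, k)`: the least number of edges whose deletion from `G` leaves a `k`-colorable graph. -/
noncomputable def hGraph {V : Type*} (G : SimpleGraph V) (k : ℕ) : ℕ :=
  sInf (deletionSizes G k)

/-- A family of finite graphs (up to isomorphism, on vertex sets `Fin m`). -/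
abbrev GraphFamily : Type := Set (Σ m : ℕ, SimpleGraph (Fin m))

/-- `G` contains no member of the family `𝓗` as a (not necessarily induced) subgraph. -/
def FamilyFree {V : Type*} (𝓗 : GraphFamily) (G : SimpleGraph V) : Prop :=
  ∀ F ∈ 𝓗, F.2.Free G

/-- The values `h(G, k)` over all `n`-vertex `𝓗`-free graphs `G`. -/
def hValues (n k : ℕ) (𝓗 : GraphFamily) : Set ℕ :=
  {m | ∃ G : SimpleGraph (Fin n), FamilyFree 𝓗 G ∧ hGraph G k = m}

/-- `h(n, k, 𝓗)`: the maximum of `h(G, k)` over all `n`-vertex `𝓗`-free graphs `G`. -/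
noncomputable def hMax (n k : ℕ) (𝓗 : GraphFamily) : ℕ :=
  sSup (hValues n k 𝓗)

/-- The family consisting of the cycle `C_ℓ` only (used for `ℓ ≥ 3`). -/
def singleCycle (ℓ : ℕ) : GraphFamily :=
  {⟨ℓ, SimpleGraph.cycleGraph ℓ⟩}

/-- The family `{C_3, C_5, …, C_{2r+1}}`. -/
def oddCyclesUpTo (r : ℕ) : GraphFamily :=
  {F | ∃ i : ℕ, 1 ≤ i ∧ i ≤ r ∧ F = ⟨2 * i + 1, SimpleGraph.cycleGraph (2 * i + 1)⟩}

/-- For `k ≥ 1` and a finite graph, the infimum defining `h(G, k)` is a minimum. -/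
theorem hGraph_isLeast {V : Type*} [Finite V] (G : SimpleGraph V) {k : ℕ} (hk : 1 ≤ k) :
    IsLeast (deletionSizes G k) (hGraph G k) := by
  have hne : (deletionSizes G k).Nonempty := by
    have hfin : G.edgeSet.Finite := Set.toFinite _
    refine ⟨_, hfin.toFinset, by simp, ?_, rfl⟩
    have hbot : G.deleteEdges (hfin.toFinset : Set (Sym2 V)) = ⊥ := by
      ext a b
      simp [SimpleGraph.deleteEdges_adj]
    rw [hbot]
    exact ⟨SimpleGraph.Coloring.mk (fun _ => ⟨0, hk⟩) (fun h => h.elim)⟩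
  exact ⟨Nat.sInf_mem hne, fun m hm => Nat.sInf_le hm⟩

/-- If some `n`-vertex graph is `𝓗`-free, the supremum defining `h(n, k, 𝓗)` is a maximum. -/
theorem hMax_isGreatest (n k : ℕ) (𝓗 : GraphFamily)
    (hfree : ∃ G : SimpleGraph (Fin n), FamilyFree 𝓗 G) :
    IsGreatest (hValues n k 𝓗) (hMax n k 𝓗) := by
  have hb : BddAbove (hValues n k 𝓗) := by
    refine Set.Finite.bddAbove (Set.Finite.subset
      (Set.finite_range (fun G : SimpleGraph (Fin n) => hGraph G k)) ?_)
    rintro m ⟨G, _, rfl⟩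
    exact ⟨G, rfl⟩
  obtain ⟨G, hG⟩ := hfree
  exact ⟨Nat.sSup_mem ⟨_, G, hG, rfl⟩ hb, fun m hm => le_csSup hb hm⟩

end EdgeDeletion

/-!
Both estimates start from a graph `G` on `n` vertices without `C_{2r+1}`.

**Removing shorter odd cycles.** For `l < r` let `H` be the graph of all edges of `G` that lie on
some `C_{2l+1}`. If `H` had more than a constant times `n^{3/2}` edges, then counting pairs of
neighbors with few common neighbors yields a vertex `y` and a set `Q` of neighbors of `y` in which
every vertex has many partners with many common neighbors (`exists_rich_neighbors`). For `u ∈ Q`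
the edge `uy` lies on a `C_{2l+1}`. Replacing `u` by a partner in `Q`, reached through a common
neighbor outside the cycle, lengthens the cycle by two, and `r - l` such steps give a `C_{2r+1}`
(`sum_degree_sq_oddCycleEdges_le`). So deleting the edges of `H` for all `l < r` costs
`O(n^{3/2})` edges and leaves no odd cycle of length at most `2r + 1`.

**Coloring with few monochromatic edges.** In `G` each distance layer `N_i(v)`, `i ≤ r`, has
bounded chromatic number (`IsParentMap.exists_layer_coloring`): sort the edges `xy` inside the
layer by the height at which the ancestors of `x` and `y` in a tree of shortest paths meet, and
orient them by an order of the ancestors just below that height. An oriented path of the right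
length closes up through the tree to a `C_{2r+1}`, so lengths of longest oriented paths give
proper colorings.

Given at most `m` vertices, put `D = m / k^r`. If all degrees exceed `D`, some ball of radius at
most `r` grows at most by the factor `k` in the next step, and its best color class is an
independent set `I` for which the next ball contains `I` and all its neighbors and has `O(k |I|)`
vertices. Removing such balls, and vertices of degree at most `D` when there are any, one exhausts
the graph. Either the balls make up half of it, or the vertices of low degree do, and then a
class of a balanced coloring of these with `k` colors has few inner edges. In both cases there is a color class with a
fraction of order `1 / k` of the vertices and at most `O(D / k)` inner edges per vertex
(`exists_color_class`). After `O(k)` classes only a small fraction of the vertices is left, which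
is colored with half as many colors; the costs form a geometric series with sum `O(n² / k^{r+1})`
(`exists_splits_two_pow`).
-/

namespace EdgeDeletion

open Finset

/-! ### Closing a path to a cycle -/

section Cycles

variable {V : Type*} {G : SimpleGraph V}

theorem cycleGraph_isContained_of_isPath {u v : V} (p : G.Walk u v) (hp : p.IsPath)
    (hlen : 2 ≤ p.length) (h : G.Adj v u) :
    (SimpleGraph.cycleGraph (p.length + 1)).IsContained G := by
  rw [SimpleGraph.cycleGraph_isContained_iff (by omega)]
  refine ⟨v, .cons h p, ?_, by simp⟩
  rw [SimpleGraph.Walk.cons_isCycle_iff]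
  refine ⟨hp, fun hmem => ?_⟩
  rw [Sym2.eq_swap] at hmem
  have := hp.length_eq_one_of_mem_edges hmem
  omega

end Cycles

/-! ### Bounded colorings of distance layers -/

/-- If `C ℓ x` reads "some `R`-chain of length `ℓ` ends in `x`" and no chain has length `L`, then
the length of a longest chain is a rank function for `R` with fewer than `L + 1` values. -/
theorem exists_rank {α : Type*} (C : ℕ → α → Prop) (R : α → α → Prop) (L : ℕ) (hL : 0 < L)
    (h0 : ∀ x y, R x y → C 0 x) (hs : ∀ ℓ x y, C ℓ x → R x y → C (ℓ + 1) y)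
    (hno : ∀ x, ¬ C L x) :
    ∃ f : α → ℕ, (∀ x, f x < L) ∧ ∀ x y, R x y → f x < f y := by
  classical
  refine ⟨fun x => Nat.findGreatest (fun ℓ => C ℓ x) (L - 1), fun x => ?_, fun x y hxy => ?_⟩
  · exact (Nat.findGreatest_le (P := fun ℓ => C ℓ x) (L - 1)).trans_lt (by omega)
  · have h1 : C (Nat.findGreatest (fun ℓ => C ℓ x) (L - 1)) x :=
      Nat.findGreatest_spec (P := fun ℓ => C ℓ x) (Nat.zero_le _) (h0 x y hxy)
    have h2 := hs _ _ _ h1 hxy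
    have h3 := Nat.findGreatest_le (P := fun ℓ => C ℓ x) (L - 1)
    refine Nat.lt_of_succ_le (Nat.le_findGreatest ?_ h2)
    change Nat.findGreatest (fun ℓ => C ℓ x) (L - 1) + 1 ≤ L - 1
    by_contra hlt
    have h4 : Nat.findGreatest (fun ℓ => C ℓ x) (L - 1) + 1 = L := by omega
    rw [h4] at h2
    exact hno y h2

section Layers

variable {V : Type*} {G : SimpleGraph V}

/-- A parent map `p` for a level function `lev`: every vertex of positive level is adjacent to its
parent, which is one level lower, and the parent of every vertex of level `1` is `root`. -/
structure IsParentMap (G : SimpleGraph V) (lev : V → ℕ) (p : V → V) (root : V) : Prop where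
  adj : ∀ x, 0 < lev x → G.Adj x (p x)
  lev_parent : ∀ x, lev (p x) = lev x - 1
  parent_eq_root : ∀ x, lev x = 1 → p x = root

variable {lev : V → ℕ} {p : V → V} {root : V}

theorem IsParentMap.lev_iterate (hp : IsParentMap G lev p root) (x : V) (j : ℕ) :
    lev (p^[j] x) = lev x - j := by
  induction j with
  | zero => simp
  | succ j ih => rw [Function.iterate_succ_apply', hp.lev_parent, ih]; omega

theorem IsParentMap.iterate_eq_root (hp : IsParentMap G lev p root) {x : V} (hx : 0 < lev x) :
    p^[lev x] x = root := by
  obtain ⟨j, hj⟩ : ∃ j, lev x = j + 1 := ⟨lev x - 1, by omega⟩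
  rw [hj, Function.iterate_succ_apply']
  apply hp.parent_eq_root
  rw [hp.lev_iterate, hj]
  omega

theorem IsParentMap.exists_path (hp : IsParentMap G lev p root) (g : ℕ) :
    ∀ x, g ≤ lev x → ∃ W : G.Walk x (p^[g] x), W.IsPath ∧ W.length = g ∧
      ∀ w ∈ W.support, ∃ j ≤ g, w = p^[j] x := by
  induction g with
  | zero => exact fun x _ => ⟨.nil, by simp, rfl, by simp⟩
  | succ g ih =>
    intro x hx
    rw [Function.iterate_succ_apply]
    obtain ⟨W, hW, hlen, hsup⟩ := ih (p x) (by rw [hp.lev_parent]; omega)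
    refine ⟨.cons (hp.adj x (by omega)) W, ?_, ?_, ?_⟩
    · rw [SimpleGraph.Walk.cons_isPath_iff]
      refine ⟨hW, fun hmem => ?_⟩
      obtain ⟨j, hj, hx'⟩ := hsup _ hmem
      have := congrArg lev hx'
      rw [hp.lev_iterate, hp.lev_parent] at this
      omega
    · simp [hlen]
    · intro w hw
      rw [SimpleGraph.Walk.support_cons, List.mem_cons] at hw
      rcases hw with rfl | hw
      · exact ⟨0, by omega, rfl⟩
      · obtain ⟨j, hj, rfl⟩ := hsup _ hw
        exact ⟨j + 1, by omega, rfl⟩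

variable [LinearOrder V]

/-- Adjacent vertices `x`, `y` of level `i` whose lowest common ancestor is `g + 1` levels up,
oriented by the order of their ancestors just below it. -/
def BranchLT (G : SimpleGraph V) (lev : V → ℕ) (p : V → V) (i g : ℕ) (x y : V) : Prop :=
  G.Adj x y ∧ lev x = i ∧ lev y = i ∧ p^[g + 1] x = p^[g + 1] y ∧ p^[g] x < p^[g] y

/-- A `BranchLT`-chain of length `ℓ` from some `x₀` to `x`, followed backwards from `x` to `x₀`
and continued from `x₀` along its ancestors up to height `g`. -/
def BranchChain (G : SimpleGraph V) (lev : V → ℕ) (p : V → V) (i g ℓ : ℕ) (x : V) : Prop :=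
  lev x = i ∧ ∃ x₀, ∃ W : G.Walk x (p^[g] x₀), W.IsPath ∧ W.length = g + ℓ ∧
    lev x₀ = i ∧ p^[g + 1] x₀ = p^[g + 1] x ∧ p^[g] x₀ ≤ p^[g] x ∧
    (1 ≤ ℓ → p^[g] x₀ ≠ p^[g] x) ∧
    ∀ w ∈ W.support, (lev w = i ∧ p^[g] w ≤ p^[g] x) ∨ (lev w < i ∧ ∃ j ≤ g, w = p^[j] x₀)

theorem IsParentMap.branchChain_zero (hp : IsParentMap G lev p root) {i g : ℕ} (hg : g ≤ i)
    {x : V} (hx : lev x = i) : BranchChain G lev p i g 0 x := by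
  obtain ⟨W, hW, hlen, hsup⟩ := hp.exists_path g x (by omega)
  refine ⟨hx, x, W, hW, hlen, hx, rfl, le_rfl, by simp, fun w hw => ?_⟩
  obtain ⟨j, hj, rfl⟩ := hsup w hw
  rcases Nat.eq_zero_or_pos j with rfl | hj'
  · exact Or.inl ⟨hx, le_rfl⟩
  · exact Or.inr ⟨by rw [hp.lev_iterate]; omega, j, hj, rfl⟩

theorem BranchChain.succ {i g ℓ : ℕ} {x y : V} (hx : BranchChain G lev p i g ℓ x)
    (hxy : BranchLT G lev p i g x y) : BranchChain G lev p i g (ℓ + 1) y := by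
  obtain ⟨-, x₀, W, hW, hlen, hx₀, hanc, hle, -, hsup⟩ := hx
  obtain ⟨hadj, -, hy, hanc', hlt⟩ := hxy
  refine ⟨hy, x₀, .cons hadj.symm W, ?_, by simp [hlen]; omega, hx₀, hanc.trans hanc',
    (hle.trans_lt hlt).le, fun _ => (hle.trans_lt hlt).ne, fun w hw => ?_⟩
  · rw [SimpleGraph.Walk.cons_isPath_iff]
    refine ⟨hW, fun hmem => ?_⟩
    rcases hsup y hmem with h | h
    · exact absurd h.2 (not_le.mpr hlt)
    · omega
  · rw [SimpleGraph.Walk.support_cons, List.mem_cons] at hw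
    rcases hw with rfl | hw
    · exact Or.inl ⟨hy, le_rfl⟩
    · rcases hsup w hw with h | h
      · exact Or.inl ⟨h.1, h.2.trans hlt.le⟩
      · exact Or.inr h

/-- Prolonging a chain from its last vertex `x` along the ancestors of `x`, up to the common
ancestor of all vertices of the chain, closes a cycle. -/
theorem IsParentMap.cycle_of_branchChain (hp : IsParentMap G lev p root) {i g ℓ : ℕ}
    (hg : g + 1 ≤ i) (hℓ : 1 ≤ ℓ) {x : V} (hx : BranchChain G lev p i g ℓ x) :
    (SimpleGraph.cycleGraph (2 * g + ℓ + 2)).IsContained G := by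
  obtain ⟨hxi, x₀, W, hW, hlen, hx₀, hanc, hle, hne, hsup⟩ := hx
  have key : ∀ j ≤ g + 1, ∃ W' : G.Walk (p^[j] x) (p^[g] x₀), W'.IsPath ∧
      W'.length = g + ℓ + j ∧
      ∀ w ∈ W'.support, w ∈ W.support ∨ ∃ a ≤ j, w = p^[a] x := by
    intro j
    induction j with
    | zero => exact fun _ => ⟨W, hW, hlen, fun w hw => Or.inl hw⟩
    | succ j ih =>
      intro hj
      obtain ⟨W', hW', hlen', hsup'⟩ := ih (by omega)
      have hlevj : lev (p^[j] x) = i - j := by rw [hp.lev_iterate, hxi]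
      have hadj : G.Adj (p^[j + 1] x) (p^[j] x) := by
        rw [Function.iterate_succ_apply']
        exact (hp.adj _ (by omega)).symm
      refine ⟨.cons hadj W', ?_, ?_, fun w hw => ?_⟩
      · rw [SimpleGraph.Walk.cons_isPath_iff]
        refine ⟨hW', fun hmem => ?_⟩
        have hlevj1 : lev (p^[j + 1] x) = i - (j + 1) := by rw [hp.lev_iterate, hxi]
        rcases hsup' _ hmem with hmem | ⟨a, ha, h⟩
        · rcases hsup _ hmem with ⟨h, -⟩ | ⟨-, b, hb, h⟩
          · omega
          · have hlevb : lev (p^[b] x₀) = i - b := by rw [hp.lev_iterate, hx₀]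
            rw [h] at hlevj1
            obtain rfl : b = j + 1 := by omega
            apply hne hℓ
            obtain ⟨d, rfl⟩ : ∃ d, g = d + (j + 1) := ⟨g - (j + 1), by omega⟩
            rw [Function.iterate_add_apply, Function.iterate_add_apply p d, h]
        · have := congrArg lev h
          rw [hp.lev_iterate x a, hlevj1, hxi] at this
          omega
      · rw [SimpleGraph.Walk.length_cons, hlen']
        omega
      · rw [SimpleGraph.Walk.support_cons, List.mem_cons] at hw
        rcases hw with rfl | hw
        · exact Or.inr ⟨j + 1, le_rfl, rfl⟩
        · rcases hsup' w hw with h | ⟨a, ha, h⟩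
          · exact Or.inl h
          · exact Or.inr ⟨a, by omega, h⟩
  obtain ⟨W', hW', hlen', -⟩ := key (g + 1) le_rfl
  have hadj : G.Adj (p^[g] x₀) (p^[g + 1] x) := by
    rw [← hanc, Function.iterate_succ_apply']
    exact hp.adj _ (by rw [hp.lev_iterate]; omega)
  have := cycleGraph_isContained_of_isPath W' hW' (by omega) hadj
  rwa [show W'.length + 1 = 2 * g + ℓ + 2 by omega] at this

/-- In a graph without `C_{2r+1}`, the vertices of a fixed level `i ≤ r` can be properly colored
with `(2r) ^ r` colors. -/
theorem IsParentMap.exists_layer_coloring (hp : IsParentMap G lev p root) {r : ℕ} (hr : 1 ≤ r)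
    (hG : (SimpleGraph.cycleGraph (2 * r + 1)).Free G) {i : ℕ} (hi : 1 ≤ i) (hir : i ≤ r) :
    ∃ f : V → Fin r → Fin (2 * r), ∀ x y, lev x = i → lev y = i → G.Adj x y → f x ≠ f y := by
  have hrank : ∀ g : Fin r, ∃ f : V → ℕ, (∀ x, f x < 2 * r) ∧
      ((g : ℕ) + 1 ≤ i → ∀ x y, BranchLT G lev p i g x y → f x < f y) := by
    intro g
    by_cases hg : (g : ℕ) + 1 ≤ i
    · obtain ⟨f, hf, hf'⟩ := exists_rank (BranchChain G lev p i g) (BranchLT G lev p i g)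
        (2 * r - 1 - 2 * g) (by omega)
        (fun x y hxy => hp.branchChain_zero (by omega) hxy.2.1)
        (fun ℓ x y hx hxy => hx.succ hxy)
        (fun x hx => hG (by
          have := hp.cycle_of_branchChain hg (by omega) hx
          rwa [show 2 * (g : ℕ) + (2 * r - 1 - 2 * g) + 2 = 2 * r + 1 by omega] at this))
      exact ⟨f, fun x => (hf x).trans_le (by omega), fun _ => hf'⟩
    · exact ⟨fun _ => 0, fun _ => Nat.mul_pos two_pos hr, fun h => absurd h hg⟩
  choose f hf hlt using hrank
  refine ⟨fun x g => ⟨f g x, hf g x⟩, fun x y hx hy hadj heq => ?_⟩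
  -- the least height at which the ancestors of `x` and `y` agree is attained below the root
  have hroot : p^[i] x = p^[i] y := by
    have h1 := hp.iterate_eq_root (x := x) (by omega)
    have h2 := hp.iterate_eq_root (x := y) (by omega)
    rw [hx] at h1
    rw [hy] at h2
    rw [h1, h2]
  classical
  have hex : ∃ h, p^[h] x = p^[h] y := ⟨i, hroot⟩
  have hfind := Nat.find_spec hex
  have hfle : Nat.find hex ≤ i := Nat.find_min' hex hroot
  have hpos : Nat.find hex ≠ 0 := by
    intro h0
    rw [h0] at hfind
    exact hadj.ne hfind
  obtain ⟨g, hg⟩ : ∃ g, Nat.find hex = g + 1 := ⟨Nat.find hex - 1, by omega⟩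
  have hneg : p^[g] x ≠ p^[g] y := Nat.find_min hex (by omega)
  rw [hg] at hfind hfle
  have hval : f ⟨g, by omega⟩ x = f ⟨g, by omega⟩ y := by
    have := congrFun heq ⟨g, by omega⟩
    simpa using this
  rcases lt_or_gt_of_ne hneg with h | h
  · exact (hlt ⟨g, by omega⟩ hfle x y ⟨hadj, hx, hy, hfind, h⟩).ne hval
  · exact (hlt ⟨g, by omega⟩ hfle y x ⟨hadj.symm, hy, hx, hfind.symm, h⟩).ne hval.symm

end Layers

/-- Shortest paths from `v` give a parent map for the distance from `v`. -/
theorem exists_isParentMap_dist {V : Type*} (G : SimpleGraph V) (v : V) :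
    ∃ p : V → V, IsParentMap G (G.dist v) p v := by
  have h : ∀ x, ∃ y, (0 < G.dist v x → G.Adj x y) ∧ G.dist v y = G.dist v x - 1 := by
    intro x
    rcases Nat.eq_zero_or_pos (G.dist v x) with h0 | h0
    · exact ⟨x, by omega, by omega⟩
    · obtain ⟨W, hW⟩ := SimpleGraph.exists_walk_of_dist_ne_zero h0.ne'
      have hrev : W.reverse.length = G.dist v x := by simpa using hW
      generalize W.reverse = Q at hrev
      cases Q with
      | nil => simp at h0
      | cons hadj q =>
        rename_i y
        refine ⟨y, fun _ => hadj, ?_⟩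
        have h1 : G.dist v y ≤ q.length := by
          rw [SimpleGraph.dist_comm]; exact G.dist_le q
        have h2 : q.length + 1 = G.dist v x := by simpa using hrev
        have h3 : G.Reachable v y := q.reachable.symm
        obtain ⟨q', hq'⟩ := h3.exists_walk_length_eq_dist
        have h4 := G.dist_le (q'.concat hadj.symm)
        rw [SimpleGraph.Walk.length_concat] at h4
        omega
  choose p hp using h
  refine ⟨p, fun x => (hp x).1, fun x => (hp x).2, fun x hx => ?_⟩
  have h1 := (hp x).1 (by omega)
  have h2 := (hp x).2
  rw [hx] at h2
  have h3 : G.Reachable v x := SimpleGraph.Reachable.of_dist_ne_zero (by omega)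
  exact ((h3.trans h1.reachable).dist_eq_zero_iff.mp (by omega)).symm

/-! ### Counting adjacent pairs -/

section Pairs

open scoped Classical

variable {V : Type*}

/-- The number of ordered pairs of adjacent vertices of `W`, that is, twice the number of edges
of `G` inside `W`. -/
noncomputable def adjPairs (G : SimpleGraph V) (W : Finset V) : ℕ :=
  ∑ x ∈ W, #{y ∈ W | G.Adj x y}

/-- The subgraph formed by the edges that are monochromatic under `f`. -/
def monoGraph (G : SimpleGraph V) (f : V → ℕ) : SimpleGraph V where
  Adj x y := G.Adj x y ∧ f x = f y
  symm := ⟨fun _ _ h => ⟨h.1.symm, h.2.symm⟩⟩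
  loopless := ⟨fun _ h => h.1.ne rfl⟩

/-- The subgraph formed by the edges with both ends in `W`. -/
def restrictTo (G : SimpleGraph V) (W : Finset V) : SimpleGraph V where
  Adj x y := G.Adj x y ∧ x ∈ W ∧ y ∈ W
  symm := ⟨fun _ _ h => ⟨h.1.symm, h.2.2, h.2.1⟩⟩
  loopless := ⟨fun _ h => h.1.ne rfl⟩

theorem adjPairs_le_sq (G : SimpleGraph V) (W : Finset V) : adjPairs G W ≤ #W ^ 2 := by
  rw [adjPairs, sq, ← smul_eq_mul]
  exact sum_le_card_nsmul _ _ _ fun x _ => card_filter_le _ _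

theorem adjPairs_congr {G G' : SimpleGraph V} {W : Finset V}
    (h : ∀ x ∈ W, ∀ y ∈ W, G.Adj x y ↔ G'.Adj x y) : adjPairs G W = adjPairs G' W :=
  sum_congr rfl fun x hx => congrArg card (filter_congr fun y hy => h x hx y hy)

theorem adjPairs_insert [DecidableEq V] (G : SimpleGraph V) {W : Finset V} {v : V} (hv : v ∉ W) :
    adjPairs G (insert v W) = adjPairs G W + 2 * #{y ∈ W | G.Adj v y} := by
  have h1 : ∀ x ∈ W, #{y ∈ insert v W | G.Adj x y}
      = #{y ∈ W | G.Adj x y} + if G.Adj v x then 1 else 0 := by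
    intro x _
    rw [filter_insert]
    by_cases h : G.Adj x v
    · rw [if_pos h, if_pos h.symm, card_insert_of_notMem (by simp [hv])]
    · rw [if_neg h, if_neg fun h' => h h'.symm, add_zero]
  rw [adjPairs, sum_insert hv, sum_congr rfl h1, sum_add_distrib, filter_insert,
    if_neg (G.loopless.irrefl v), ← card_filter, adjPairs]
  ring

theorem adjPairs_union [DecidableEq V] {G : SimpleGraph V} {U₁ U₂ : Finset V} (hd : Disjoint U₁ U₂)
    (h : ∀ x ∈ U₁, ∀ y ∈ U₂, ¬ G.Adj x y) :
    adjPairs G (U₁ ∪ U₂) = adjPairs G U₁ + adjPairs G U₂ := by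
  rw [adjPairs, sum_union hd]
  congr 1
  · refine sum_congr rfl fun x hx => ?_
    rw [filter_union, filter_false_of_mem (h x hx), union_empty]
  · refine sum_congr rfl fun x hx => ?_
    rw [filter_union, filter_false_of_mem (fun y hy hxy => h y hy x hx hxy.symm), empty_union]

theorem adjPairs_eq_zero {G : SimpleGraph V} {I : Finset V}
    (h : ∀ x ∈ I, ∀ y ∈ I, ¬ G.Adj x y) : adjPairs G I = 0 :=
  sum_eq_zero fun x hx => by rw [filter_false_of_mem (h x hx), card_empty]

theorem sum_adjPairs_fiber (G : SimpleGraph V) {f : V → ℕ} {k : ℕ} {L : Finset V}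
    (hf : ∀ x ∈ L, f x < k) :
    ∑ c ∈ range k, adjPairs G {x ∈ L | f x = c} = adjPairs (monoGraph G f) L := by
  rw [adjPairs, ← sum_fiberwise_of_maps_to (t := range k) (g := f)
    (fun x hx => mem_range.mpr (hf x hx))]
  refine sum_congr rfl fun c _ => sum_congr rfl fun x hx => ?_
  rw [filter_filter]
  refine congrArg card (filter_congr fun y _ => ?_)
  rw [← (mem_filter.mp hx).2]
  simp only [monoGraph]
  tauto

/-- Coloring the vertices greedily with `k` colors leaves at most a fraction `1 / k` of the edges
monochromatic. -/
theorem exists_coloring_mul_le (G : SimpleGraph V) {k : ℕ} (hk : 1 ≤ k) (L : Finset V) :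
    ∃ f : V → ℕ, (∀ x, f x < k) ∧ k * adjPairs (monoGraph G f) L ≤ adjPairs G L := by
  induction L using Finset.induction_on with
  | empty => exact ⟨fun _ => 0, fun _ => hk, by simp [adjPairs]⟩
  | insert v L hv ih =>
    obtain ⟨f, hf, hle⟩ := ih
    obtain ⟨c, hc, hmin⟩ := exists_min_image (range k)
      (fun c => #{y ∈ {y ∈ L | G.Adj v y} | f y = c}) ⟨0, mem_range.mpr hk⟩
    have hdeg : k * #{y ∈ {y ∈ L | G.Adj v y} | f y = c} ≤ #{y ∈ L | G.Adj v y} := by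
      rw [card_eq_sum_card_fiberwise (f := f) (s := {y ∈ L | G.Adj v y}) (t := range k)
        (fun x _ => mem_coe.mpr (mem_range.mpr (hf x)))]
      simpa using card_nsmul_le_sum (range k) _ _ hmin
    refine ⟨Function.update f v c, fun x => ?_, ?_⟩
    · by_cases hx : x = v
      · subst hx; simpa using hc
      · simpa [Function.update_of_ne hx] using hf x
    · have hne : ∀ x ∈ L, Function.update f v c x = f x := fun x hx =>
        Function.update_of_ne (ne_of_mem_of_not_mem hx hv) _ _
      have h1 : adjPairs (monoGraph G (Function.update f v c)) L
          = adjPairs (monoGraph G f) L := by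
        refine adjPairs_congr fun x hx y hy => ?_
        simp only [monoGraph, hne x hx, hne y hy]
      have h2 : #{y ∈ L | (monoGraph G (Function.update f v c)).Adj v y}
          = #{y ∈ {y ∈ L | G.Adj v y} | f y = c} := by
        rw [filter_filter]
        refine congrArg card (filter_congr fun y hy => ?_)
        simp only [monoGraph, hne y hy, Function.update_self, eq_comm]
      rw [adjPairs_insert _ hv, adjPairs_insert _ hv, h1, h2]
      linarith

end Pairs

/-! ### Large color classes with few inner edges -/

section Classes

open scoped Classical

variable {V : Type*} [LinearOrder V] {G : SimpleGraph V}

/-- Region growing: if `v` has degree more than `D` and there are at most `D k ^ r` vertices, then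
among the balls of radius `1, …, r` around `v` one grows at most by the factor `k` in the next
step. As its layers have bounded chromatic number, it contains a large independent set, all
neighbors of which lie in the next ball. -/
theorem exists_independent_in_ball {r k : ℕ} (hr : 1 ≤ r)
    (hG : (SimpleGraph.cycleGraph (2 * r + 1)).Free G) {W : Finset V}
    (hW : ∀ x y, G.Adj x y → x ∈ W) {v : V} (hv : v ∈ W) {D : ℝ}
    (hdeg : D < #{y ∈ W | G.Adj v y}) (hcard : (#W : ℝ) ≤ D * k ^ r) :
    ∃ I S : Finset V, I ⊆ S ∧ S ⊆ W ∧ v ∈ S ∧ (∀ x ∈ I, ∀ y ∈ I, ¬ G.Adj x y) ∧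
      (∀ x ∈ I, ∀ y, G.Adj x y → y ∈ S) ∧ #S ≤ k * ((r + 1) * (2 * r) ^ r) * #I := by
  set B : ℕ → Finset V := fun j => {x ∈ W | G.Reachable v x ∧ G.dist v x ≤ j} with hB
  have hslow : ∃ i, 1 ≤ i ∧ i ≤ r ∧ #(B (i + 1)) ≤ k * #(B i) := by
    by_contra! hcon
    have hgrow : ∀ j ≤ r, D * k ^ j < #(B (j + 1)) := by
      intro j
      induction j with
      | zero =>
        intro _
        rw [pow_zero, mul_one]
        refine hdeg.trans_le (Nat.cast_le.mpr (card_le_card fun y hy => ?_))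
        obtain ⟨hy, hadj⟩ := mem_filter.mp hy
        exact mem_filter.mpr ⟨hy, hadj.reachable, (SimpleGraph.dist_eq_one_iff_adj.mpr hadj).le⟩
      | succ j ih =>
        intro hj
        have h1 := ih (by omega)
        have h2 : (k : ℝ) * #(B (j + 1)) < #(B (j + 1 + 1)) := by
          exact_mod_cast hcon (j + 1) (by omega) hj
        have h3 : D * (k : ℝ) ^ (j + 1) = k * (D * k ^ j) := by ring
        rw [h3]
        exact (mul_le_mul_of_nonneg_left h1.le (Nat.cast_nonneg k)).trans_lt h2
    have h1 := hgrow r le_rfl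
    have h2 : (#(B (r + 1)) : ℝ) ≤ #W := Nat.cast_le.mpr (card_filter_le _ _)
    linarith
  obtain ⟨i, hi1, hir, hi⟩ := hslow
  obtain ⟨p, hp⟩ := exists_isParentMap_dist G v
  have hcol : ∀ d, ∃ f : V → Fin r → Fin (2 * r), 1 ≤ d → d ≤ r →
      ∀ x y, G.dist v x = d → G.dist v y = d → G.Adj x y → f x ≠ f y := by
    intro d
    by_cases hd : 1 ≤ d ∧ d ≤ r
    · obtain ⟨f, hf⟩ := hp.exists_layer_coloring hr hG hd.1 hd.2
      exact ⟨f, fun _ _ => hf⟩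
    · exact ⟨fun _ _ => ⟨0, by omega⟩, fun h1 h2 => absurd ⟨h1, h2⟩ hd⟩
  choose f hf using hcol
  let F : V → ℕ × (Fin r → Fin (2 * r)) := fun x => (G.dist v x, f (G.dist v x) x)
  let t : Finset (ℕ × (Fin r → Fin (2 * r))) := range (r + 1) ×ˢ univ
  have ht : #t = (r + 1) * (2 * r) ^ r := by simp [t]
  have hFt : ∀ x ∈ B i, F x ∈ t := by
    intro x hx
    have := (mem_filter.mp hx).2.2
    simp only [F, t, mem_product, mem_range, mem_univ, and_true]
    omega
  have hvB : ∀ j, v ∈ B j := fun j =>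
    mem_filter.mpr ⟨hv, SimpleGraph.Reachable.refl v, by simp⟩
  obtain ⟨b, -, hb⟩ := exists_max_image t (fun b => #{x ∈ B i | F x = b}) ⟨F v, hFt v (hvB i)⟩
  have hBi : #(B i) ≤ #{x ∈ B i | F x = b} * #t := card_le_mul_card_image_of_maps_to hFt _ hb
  refine ⟨{x ∈ B i | F x = b}, B (i + 1), ?_, filter_subset _ _, hvB _, ?_, ?_, ?_⟩
  · intro x hx
    obtain ⟨hxW, hxr, hxd⟩ := mem_filter.mp (mem_filter.mp hx).1
    exact mem_filter.mpr ⟨hxW, hxr, by omega⟩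
  · intro x hx y hy hadj
    obtain ⟨hx, hxb⟩ := mem_filter.mp hx
    obtain ⟨hy, hyb⟩ := mem_filter.mp hy
    obtain ⟨-, hxr, hxd⟩ := mem_filter.mp hx
    obtain ⟨-, hyr, hyd⟩ := mem_filter.mp hy
    obtain ⟨hd, hc⟩ := Prod.ext_iff.mp (hxb.trans hyb.symm)
    simp only [F] at hd hc
    rcases Nat.eq_zero_or_pos (G.dist v x) with h0 | h0
    · have h1 := hxr.dist_eq_zero_iff.mp h0
      have h2 := hyr.dist_eq_zero_iff.mp (hd ▸ h0)
      exact hadj.ne (h1.symm.trans h2)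
    · rw [← hd] at hc
      exact hf _ h0 (by omega) x y rfl hd.symm hadj hc
  · intro x hx y hadj
    obtain ⟨-, hxr, hxd⟩ := mem_filter.mp (mem_filter.mp hx).1
    refine mem_filter.mpr ⟨hW y x hadj.symm, hxr.trans hadj.reachable, ?_⟩
    have h1 := hxr.dist_triangle_left (w := y)
    rw [SimpleGraph.dist_eq_one_iff_adj.mpr hadj] at h1
    omega
  · rw [ht] at hBi
    calc #(B (i + 1)) ≤ k * #(B i) := hi
      _ ≤ k * (#{x ∈ B i | F x = b} * ((r + 1) * (2 * r) ^ r)) := Nat.mul_le_mul_left _ hBi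
      _ = _ := by ring

/-- Splitting off vertices of degree at most `D` (into `L`) or slowly growing balls (into `S`)
until nothing is left. -/
theorem exists_low_degree_part {r k : ℕ} (hr : 1 ≤ r)
    (hG : (SimpleGraph.cycleGraph (2 * r + 1)).Free G) {D : ℝ} (W : Finset V)
    (hcard : (#W : ℝ) ≤ D * k ^ r) :
    ∃ L I S : Finset V, L ∪ S = W ∧ I ⊆ S ∧ (∀ x ∈ I, ∀ y ∈ I, ¬ G.Adj x y) ∧
      #S ≤ k * ((r + 1) * (2 * r) ^ r) * #I ∧ (adjPairs G L : ℝ) ≤ 2 * D * #L := by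
  induction W using Finset.strongInduction with
  | H W ih =>
    rcases W.eq_empty_or_nonempty with rfl | ⟨v₀, hv₀⟩
    · exact ⟨∅, ∅, ∅, by simp [adjPairs]⟩
    by_cases hlow : ∃ v ∈ W, (#{y ∈ W | G.Adj v y} : ℝ) ≤ D
    · obtain ⟨v, hv, hd⟩ := hlow
      have hss := erase_ssubset hv
      obtain ⟨L, I, S, hLS, hIS, hI, hS, hL⟩ := ih (W.erase v) hss
        ((Nat.cast_le.mpr (card_le_card hss.subset)).trans hcard)
      have hLW : L ⊆ W.erase v := hLS ▸ subset_union_left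
      have hvL : v ∉ L := fun h => notMem_erase v W (hLW h)
      refine ⟨insert v L, I, S, ?_, hIS, hI, hS, ?_⟩
      · rw [insert_union, hLS, insert_erase hv]
      · rw [adjPairs_insert G hvL, card_insert_of_notMem hvL]
        have h1 : (#{y ∈ L | G.Adj v y} : ℝ) ≤ #{y ∈ W | G.Adj v y} :=
          Nat.cast_le.mpr (card_le_card (filter_subset_filter _ (hLW.trans hss.subset)))
        push_cast
        linarith
    · push Not at hlow
      have hG' : (SimpleGraph.cycleGraph (2 * r + 1)).Free (restrictTo G W) := fun h =>
        hG (h.trans (SimpleGraph.IsContained.of_le fun x y hxy => hxy.1))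
      obtain ⟨I₀, S₀, hIS₀, hSW₀, hv₀S, hI₀, hN₀, hc₀⟩ :=
        exists_independent_in_ball (D := D) (k := k) hr hG' (W := W) (fun x y h => h.2.1) hv₀
          (by
            have : ({y ∈ W | (restrictTo G W).Adj v₀ y} : Finset V) = {y ∈ W | G.Adj v₀ y} :=
              filter_congr fun y hy => by simp [restrictTo, hv₀, hy]
            rw [this]
            exact hlow v₀ hv₀) hcard
      have hss : W \ S₀ ⊂ W := sdiff_ssubset hSW₀ ⟨v₀, hv₀S⟩
      obtain ⟨L, I, S, hLS, hIS, hI, hS, hL⟩ := ih (W \ S₀) hss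
        ((Nat.cast_le.mpr (card_le_card hss.subset)).trans hcard)
      have hSW : S ⊆ W \ S₀ := hLS ▸ subset_union_right
      have hcross : ∀ x ∈ I₀, ∀ y ∈ I, ¬ G.Adj x y := fun x hx y hy hadj => by
        have hy' := mem_sdiff.mp (hSW (hIS hy))
        exact hy'.2 (hN₀ x hx y ⟨hadj, hSW₀ (hIS₀ hx), hy'.1⟩)
      refine ⟨L, I₀ ∪ I, S₀ ∪ S, ?_, union_subset_union hIS₀ hIS, ?_, ?_, hL⟩
      · rw [union_left_comm, hLS, union_sdiff_of_subset hSW₀]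
      · intro x hx y hy hadj
        rcases mem_union.mp hx with hx | hx <;> rcases mem_union.mp hy with hy | hy
        · exact hI₀ x hx y hy ⟨hadj, hSW₀ (hIS₀ hx), hSW₀ (hIS₀ hy)⟩
        · exact hcross x hx y hy hadj
        · exact hcross y hy x hx hadj.symm
        · exact hI x hx y hy hadj
      · have hdis : Disjoint I₀ I :=
          Disjoint.mono hIS₀ (hIS.trans hSW) disjoint_sdiff
        rw [card_union_of_disjoint hdis, mul_add]
        exact (card_union_le _ _).trans (add_le_add hc₀ hS)

/-- The constant bounding, up to the factor `k`, the ratio between a vertex set and the color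
class found in it. -/
def classConst (r : ℕ) : ℕ := 4 * ((r + 1) * (2 * r) ^ r)

theorem classConst_ge {r : ℕ} (hr : 1 ≤ r) : 4 ≤ classConst r := by
  have : 0 < (r + 1) * (2 * r) ^ r := by positivity
  rw [classConst]
  omega

/-- One color class: it takes a fraction of order `1 / k` of the vertices and has few inner
edges. Either the balls of `exists_low_degree_part` cover half of `W`, or one takes a class of a
balanced coloring of the vertices of low degree. -/
theorem exists_color_class {r k : ℕ} (hr : 1 ≤ r) (hk : 1 ≤ k)
    (hG : (SimpleGraph.cycleGraph (2 * r + 1)).Free G) {D : ℝ} (hD : 0 < D) (W : Finset V)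
    (hcard : (#W : ℝ) ≤ D * k ^ r) :
    ∃ I ⊆ W, #W ≤ classConst r * k * #I ∧ k * (adjPairs G I : ℝ) ≤ 4 * D * #I := by
  obtain ⟨L, I, S, hLS, hIS, hI, hS, hL⟩ := exists_low_degree_part hr hG W hcard
  have hWc : #W ≤ #L + #S := hLS ▸ card_union_le L S
  by_cases hhalf : #W ≤ 2 * #S
  · refine ⟨I, hIS.trans (hLS ▸ subset_union_right), ?_, ?_⟩
    · calc #W ≤ 2 * (k * ((r + 1) * (2 * r) ^ r) * #I) := hhalf.trans (Nat.mul_le_mul_left 2 hS)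
        _ ≤ 4 * (k * ((r + 1) * (2 * r) ^ r) * #I) := Nat.mul_le_mul_right _ (by norm_num)
        _ = _ := by rw [classConst]; ring
    · rw [adjPairs_eq_zero hI, Nat.cast_zero, mul_zero]
      positivity
  · obtain ⟨f, hf, hfle⟩ := exists_coloring_mul_le G hk L
    have hsum1 : ∑ c ∈ range k, (#{x ∈ L | f x = c} : ℝ) = #L := by
      exact_mod_cast (card_eq_sum_card_fiberwise (f := f) (s := L) (t := range k)
        (fun x _ => mem_coe.mpr (mem_range.mpr (hf x)))).symm
    have hsum2 : ∑ c ∈ range k, (adjPairs G {x ∈ L | f x = c} : ℝ)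
        = adjPairs (monoGraph G f) L := by
      exact_mod_cast sum_adjPairs_fiber G fun x _ => hf x
    have hfle' : (k : ℝ) * adjPairs (monoGraph G f) L ≤ 2 * D * #L :=
      le_trans (by exact_mod_cast hfle) hL
    have hk0 : (0 : ℝ) < k := by exact_mod_cast hk
    -- averaging a combination of size and inner edges gives a class that is good for both
    obtain ⟨c, -, hc⟩ : ∃ c ∈ range k, 2 * D * #L / k ≤
        4 * D * #{x ∈ L | f x = c} - k * (adjPairs G {x ∈ L | f x = c} : ℝ) := by
      refine exists_le_of_sum_le ⟨0, mem_range.mpr hk⟩ ?_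
      rw [sum_const, card_range, nsmul_eq_mul, sum_sub_distrib, ← mul_sum, ← mul_sum, hsum1,
        hsum2, mul_div_cancel₀ _ hk0.ne']
      linarith
    have hpos : (0 : ℝ) ≤ 2 * D * #L / k := by positivity
    refine ⟨{x ∈ L | f x = c}, (filter_subset _ _).trans (hLS ▸ subset_union_left), ?_, ?_⟩
    · have h1 : 2 * D * #L / k ≤ 4 * D * #{x ∈ L | f x = c} :=
        hc.trans (sub_le_self _ (by positivity))
      rw [div_le_iff₀ hk0] at h1
      have h2 : (2 * D) * #L ≤ (2 * D) * (2 * k * #{x ∈ L | f x = c}) := by linarith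
      have h3 : (#L : ℝ) ≤ 2 * k * #{x ∈ L | f x = c} :=
        le_of_mul_le_mul_left h2 (by positivity)
      have h4 : #L ≤ 2 * k * #{x ∈ L | f x = c} := by exact_mod_cast h3
      calc #W ≤ 4 * (k * #{x ∈ L | f x = c}) := by
            rw [mul_assoc] at h4; omega
        _ ≤ classConst r * (k * #{x ∈ L | f x = c}) := Nat.mul_le_mul_right _ (classConst_ge hr)
        _ = _ := by ring
    · linarith

end Classes

/-! ### Colorings with few monochromatic edges -/

section Splits

open scoped Classical

variable {V : Type*} {G : SimpleGraph V}

/-- `U` can be colored with the colors `0, …, N - 1` so that at most `c` ordered pairs of adjacent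
vertices of `U` are monochromatic. -/
def Splits (G : SimpleGraph V) (U : Finset V) (N : ℕ) (c : ℝ) : Prop :=
  ∃ f : V → ℕ, (∀ x ∈ U, f x < N) ∧ (adjPairs (monoGraph G f) U : ℝ) ≤ c

theorem Splits.of_le {U : Finset V} {N N' : ℕ} {c c' : ℝ} (h : Splits G U N c) (hN : N ≤ N')
    (hc : c ≤ c') : Splits G U N' c' := by
  obtain ⟨f, hf, hle⟩ := h
  exact ⟨f, fun x hx => (hf x hx).trans_le hN, hle.trans hc⟩

theorem adjPairs_mono_left {G G' : SimpleGraph V} (h : G ≤ G') (W : Finset V) :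
    adjPairs G W ≤ adjPairs G' W :=
  sum_le_sum fun _ _ => card_le_card (monotone_filter_right _ fun _ _ hxy => h hxy)

theorem splits_one (G : SimpleGraph V) (U : Finset V) : Splits G U 1 (adjPairs G U) :=
  ⟨fun _ => 0, fun _ _ => one_pos,
    Nat.cast_le.mpr (adjPairs_mono_left (G := monoGraph G _) (fun _ _ h => h.1) U)⟩

theorem Splits.union [DecidableEq V] {U₁ U₂ : Finset V} {N₁ N₂ : ℕ} {c₁ c₂ : ℝ} (hd : Disjoint U₁ U₂)
    (h₁ : Splits G U₁ N₁ c₁) (h₂ : Splits G U₂ N₂ c₂) :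
    Splits G (U₁ ∪ U₂) (N₁ + N₂) (c₁ + c₂) := by
  obtain ⟨f₁, hf₁, hc₁⟩ := h₁
  obtain ⟨f₂, hf₂, hc₂⟩ := h₂
  have e₁ : ∀ x ∈ U₁, (if x ∈ U₁ then f₁ x else N₁ + f₂ x) = f₁ x := fun x hx => if_pos hx
  have e₂ : ∀ x ∈ U₂, (if x ∈ U₁ then f₁ x else N₁ + f₂ x) = N₁ + f₂ x := fun x hx =>
    if_neg fun hx' => disjoint_left.mp hd hx' hx
  refine ⟨fun x => if x ∈ U₁ then f₁ x else N₁ + f₂ x, fun x hx => ?_, ?_⟩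
  · rcases mem_union.mp hx with hx | hx
    · have := hf₁ x hx
      simp only [e₁ x hx]
      omega
    · have := hf₂ x hx
      simp only [e₂ x hx]
      omega
  · rw [adjPairs_union hd]
    · have h1 : adjPairs (monoGraph G fun x => if x ∈ U₁ then f₁ x else N₁ + f₂ x) U₁
          = adjPairs (monoGraph G f₁) U₁ := adjPairs_congr fun x hx y hy => by
        simp only [monoGraph, e₁ x hx, e₁ y hy]
      have h2 : adjPairs (monoGraph G fun x => if x ∈ U₁ then f₁ x else N₁ + f₂ x) U₂
          = adjPairs (monoGraph G f₂) U₂ := adjPairs_congr fun x hx y hy => by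
        simp only [monoGraph, e₂ x hx, e₂ y hy, Nat.add_left_cancel_iff]
      rw [h1, h2]
      push_cast
      exact add_le_add hc₁ hc₂
    · rintro x hx y hy ⟨-, hxy⟩
      simp only [e₁ x hx, e₂ y hy] at hxy
      have := hf₁ x hx
      omega

/-- Removing `N` color classes one after the other. -/
theorem exists_splits_rounds [LinearOrder V] {r k : ℕ} (hr : 1 ≤ r) (hk : 1 ≤ k)
    (hG : (SimpleGraph.cycleGraph (2 * r + 1)).Free G) {D : ℝ} (hD : 0 < D) (W : Finset V)
    (hcard : (#W : ℝ) ≤ D * k ^ r) (N : ℕ) :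
    ∃ U ⊆ W, Splits G U N (4 * D / k * #U) ∧
      (#(W \ U) : ℝ) ≤ (1 - 1 / (classConst r * k)) ^ N * #W := by
  have hk0 : (0 : ℝ) < k := by exact_mod_cast hk
  have hA : (1 : ℝ) ≤ classConst r := by exact_mod_cast (classConst_ge hr).trans' (by norm_num)
  have hA0 : (0 : ℝ) < classConst r * k := by positivity
  have hAk : (1 : ℝ) ≤ classConst r * k := by
    have : (1 : ℝ) ≤ k := by exact_mod_cast hk
    nlinarith
  have hfac : (0 : ℝ) ≤ 1 - 1 / (classConst r * k) := by
    rw [sub_nonneg, div_le_one hA0]; exact hAk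
  induction N with
  | zero =>
    exact ⟨∅, empty_subset _, ⟨fun _ => 0, by simp, by simp [adjPairs]⟩, by simp⟩
  | succ N ih =>
    obtain ⟨U, hUW, hU, hc⟩ := ih
    obtain ⟨I, hIW, hI, hIc⟩ := exists_color_class hr hk hG hD (W \ U)
      ((Nat.cast_le.mpr (card_le_card sdiff_subset)).trans hcard)
    have hdis : Disjoint U I := disjoint_sdiff.mono_right hIW
    refine ⟨U ∪ I, union_subset hUW (hIW.trans sdiff_subset), ?_, ?_⟩
    · refine (hU.union hdis (splits_one G I)).of_le le_rfl ?_
      rw [card_union_of_disjoint hdis]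
      have : (adjPairs G I : ℝ) ≤ 4 * D / k * #I := by
        rw [div_mul_eq_mul_div, le_div_iff₀ hk0]
        linarith
      push_cast
      linarith
    · have h1 : W \ (U ∪ I) = (W \ U) \ I := sdiff_union_distrib _ _ _ |>.trans
        (by ext x; simp only [mem_inter, mem_sdiff]; tauto)
      have h2 : (#((W \ U) \ I) : ℝ) = #(W \ U) - #I := by
        rw [card_sdiff_of_subset hIW, Nat.cast_sub (card_le_card hIW)]
      have h3 : (#(W \ U) : ℝ) ≤ classConst r * k * #I := by exact_mod_cast hI
      have h4 : (#(W \ U) : ℝ) / (classConst r * k) ≤ #I := by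
        rw [div_le_iff₀ hA0]; linarith
      rw [h1, h2, pow_succ]
      calc (#(W \ U) : ℝ) - #I ≤ (1 - 1 / (classConst r * k)) * #(W \ U) := by
            rw [sub_mul, one_mul, one_div_mul_eq_div]; linarith
        _ ≤ (1 - 1 / (classConst r * k)) *
              ((1 - 1 / (classConst r * k)) ^ N * #W) := mul_le_mul_of_nonneg_left hc hfac
        _ = _ := by ring

/-- With `k` of order `2 ^ j`, a bounded multiple of `k` color classes cover all but a small
fraction `q` of the vertices; the rest is colored with half as many colors, which costs little
because `q` is small compared to `2 ^ (-r)`. -/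
theorem exists_splits_two_pow {r : ℕ} (hr : 1 ≤ r) :
    ∃ A : ℕ, 1 ≤ A ∧ ∀ {V : Type} [LinearOrder V] (G : SimpleGraph V),
      (SimpleGraph.cycleGraph (2 * r + 1)).Free G → ∀ (j : ℕ) (W : Finset V),
        Splits G W (A * 2 ^ j) (8 * (#W : ℝ) ^ 2 / (2 ^ j) ^ (r + 1)) := by
  have hA : (0 : ℝ) < classConst r := by
    exact_mod_cast (classConst_ge hr).trans_lt' (by norm_num)
  obtain ⟨T, hT⟩ : ∃ T : ℕ, Real.exp (-(T / classConst r)) ≤ 1 / 2 ^ (r + 2) := by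
    obtain ⟨T, hT⟩ := exists_nat_ge (-Real.log (1 / 2 ^ (r + 2)) * classConst r)
    refine ⟨T, ?_⟩
    rw [← Real.le_log_iff_exp_le (by positivity)]
    rw [← le_div_iff₀ hA] at hT
    linarith
  refine ⟨2 * T + 1, by omega, fun {V} _ G hG j => ?_⟩
  induction j with
  | zero =>
    intro W
    refine (splits_one G W).of_le (by omega) ?_
    have h1 : (adjPairs G W : ℝ) ≤ (#W : ℝ) ^ 2 := by exact_mod_cast adjPairs_le_sq G W
    rw [pow_zero, one_pow, div_one]
    nlinarith [sq_nonneg (#W : ℝ)]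
  | succ j ih =>
    intro W
    rcases W.eq_empty_or_nonempty with rfl | hW
    · exact ⟨fun _ => 0, by simp, by simp [adjPairs]⟩
    set k : ℕ := 2 ^ (j + 1) with hk
    have hk1 : 1 ≤ k := Nat.one_le_two_pow
    have hk0 : (0 : ℝ) < k := by exact_mod_cast hk1
    have hw0 : (0 : ℝ) < #W := by exact_mod_cast hW.card_pos
    obtain ⟨U, hUW, hU, hc⟩ := exists_splits_rounds hr hk1 hG (D := #W / k ^ r) (by positivity) W
      (by rw [div_mul_cancel₀ _ (by positivity)]) (T * k)
    have hq : (#(W \ U) : ℝ) ≤ 1 / 2 ^ (r + 2) * #W := by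
      refine hc.trans (mul_le_mul_of_nonneg_right (le_trans ?_ hT) hw0.le)
      have h1 : 1 - 1 / (classConst r * k : ℝ) ≤ Real.exp (-(1 / (classConst r * k))) :=
        Real.one_sub_le_exp_neg _
      have h0 : (0 : ℝ) ≤ 1 - 1 / (classConst r * k) := by
        have h4 : (4 : ℝ) ≤ classConst r := by exact_mod_cast classConst_ge hr
        have h5 : (1 : ℝ) ≤ k := by exact_mod_cast hk1
        rw [sub_nonneg, div_le_one (by positivity)]
        nlinarith
      calc (1 - 1 / (classConst r * k : ℝ)) ^ (T * k)
          ≤ Real.exp (-(1 / (classConst r * k))) ^ (T * k) := pow_le_pow_left₀ h0 h1 _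
        _ = Real.exp (-(T / classConst r)) := by
          rw [← Real.exp_nat_mul]
          congr 1
          push_cast
          field_simp
    have hsplit := hU.union disjoint_sdiff (ih (W \ U))
    rw [union_sdiff_of_subset hUW] at hsplit
    refine hsplit.of_le ?_ ?_
    · rw [hk, pow_succ]
      have : 0 < 2 ^ j := by positivity
      nlinarith
    · have h2 : ((2 : ℝ) ^ (j + 1)) = k := by rw [hk]; push_cast; rfl
      have h3 : ((2 : ℝ) ^ j) = k / 2 := by rw [← h2, pow_succ]; ring
      rw [h2, h3]
      have hU' : (#U : ℝ) ≤ #W := Nat.cast_le.mpr (card_le_card hUW)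
      have e1 : 4 * ((#W : ℝ) / k ^ r) / k * #U ≤ 4 * (#W : ℝ) ^ 2 / k ^ (r + 1) := by
        calc 4 * ((#W : ℝ) / k ^ r) / k * #U ≤ 4 * ((#W : ℝ) / k ^ r) / k * #W :=
              mul_le_mul_of_nonneg_left hU' (by positivity)
          _ = _ := by rw [pow_succ (k : ℝ) r]; field_simp
      have e2 : 8 * (#(W \ U) : ℝ) ^ 2 / (k / 2) ^ (r + 1)
          ≤ 4 * (#W : ℝ) ^ 2 / k ^ (r + 1) := by
        have h5 : (#(W \ U) : ℝ) ^ 2 ≤ (1 / 2 ^ (r + 2) * #W) ^ 2 :=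
          pow_le_pow_left₀ (Nat.cast_nonneg _) hq 2
        have h6 : (1 : ℝ) ≤ 2 ^ r := one_le_pow₀ (by norm_num)
        calc 8 * (#(W \ U) : ℝ) ^ 2 / (k / 2) ^ (r + 1)
            ≤ 8 * (1 / 2 ^ (r + 2) * #W) ^ 2 / (k / 2) ^ (r + 1) := by gcongr
          _ = (1 / 2 ^ r) * (#W : ℝ) ^ 2 / k ^ (r + 1) := by
            rw [div_pow]
            field_simp
            ring
          _ ≤ 4 * (#W : ℝ) ^ 2 / k ^ (r + 1) := by
            have h7 : (1 : ℝ) / 2 ^ r ≤ 4 := by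
              rw [div_le_iff₀ (by positivity)]; linarith
            gcongr
      calc _ ≤ 4 * (#W : ℝ) ^ 2 / k ^ (r + 1) + 4 * (#W : ℝ) ^ 2 / k ^ (r + 1) :=
            add_le_add e1 e2
        _ = _ := by ring

end Splits

/-! ### From colorings to edge deletions -/

section Deletion

open scoped Classical

variable {n : ℕ}

theorem hGraph_le_of_colorable {V : Type*} {G : SimpleGraph V} {k : ℕ} (s : Finset (Sym2 V))
    (hs : (s : Set (Sym2 V)) ⊆ G.edgeSet)
    (hc : (G.deleteEdges (s : Set (Sym2 V))).Colorable k) : hGraph G k ≤ #s :=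
  Nat.sInf_le ⟨s, hs, hc, rfl⟩

theorem card_edgeFinset_le_adjPairs {V : Type*} [Fintype V] (G : SimpleGraph V) :
    #G.edgeFinset ≤ adjPairs G univ := by
  have h : adjPairs G univ = ∑ x, G.degree x := by
    refine sum_congr rfl fun x _ => ?_
    rw [← SimpleGraph.card_neighborFinset_eq_degree, SimpleGraph.neighborFinset_eq_filter]
  have := G.sum_degrees_eq_twice_card_edges
  rw [h, this]
  omega

theorem hGraph_le_of_splits {G : SimpleGraph (Fin n)} {k : ℕ} {c : ℝ}
    (h : Splits G univ k c) : (hGraph G k : ℝ) ≤ c := by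
  obtain ⟨f, hf, hc⟩ := h
  refine le_trans (Nat.cast_le.mpr ?_) hc
  refine le_trans (hGraph_le_of_colorable (monoGraph G f).edgeFinset ?_ ?_)
    (card_edgeFinset_le_adjPairs _)
  · rw [SimpleGraph.coe_edgeFinset]
    exact SimpleGraph.edgeSet_mono fun _ _ hxy => hxy.1
  · refine ⟨SimpleGraph.Coloring.mk (fun x => ⟨f x, hf x (mem_univ x)⟩) fun {x y} hxy heq => ?_⟩
    rw [SimpleGraph.deleteEdges_adj, SimpleGraph.coe_edgeFinset, SimpleGraph.mem_edgeSet] at hxy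
    exact hxy.2 ⟨hxy.1, by simpa using heq⟩

/-- Graphs without `C_{2r+1}` become `k`-colorable after deleting `O(n² / k^{r+1})` edges. -/
theorem exists_hGraph_le {r : ℕ} (hr : 1 ≤ r) :
    ∃ c : ℝ, 0 < c ∧ ∀ (n k : ℕ) (G : SimpleGraph (Fin n)), 1 ≤ k →
      (SimpleGraph.cycleGraph (2 * r + 1)).Free G →
        (hGraph G k : ℝ) ≤ c * ((n : ℝ) ^ 2 / (k : ℝ) ^ (r + 1)) := by
  obtain ⟨A, hA, hsplit⟩ := exists_splits_two_pow hr
  have hA0 : (0 : ℝ) < A := by exact_mod_cast hA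
  refine ⟨8 * (2 * A) ^ (r + 1), by positivity, fun n k G hk hG => ?_⟩
  have hk0 : (0 : ℝ) < k := by exact_mod_cast hk
  rcases lt_or_ge k A with hkA | hkA
  · have h1 : (hGraph G k : ℝ) ≤ (n : ℝ) ^ 2 := by
      refine (hGraph_le_of_splits ((splits_one G univ).of_le hk le_rfl)).trans ?_
      have := adjPairs_le_sq G univ
      rw [card_univ, Fintype.card_fin] at this
      exact_mod_cast this
    have h2 : (k : ℝ) ^ (r + 1) ≤ 8 * (2 * A) ^ (r + 1) := by
      have h3 : (k : ℝ) ≤ 2 * A := by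
        have : (k : ℝ) ≤ A := by exact_mod_cast hkA.le
        linarith
      have h4 : (k : ℝ) ^ (r + 1) ≤ (2 * A) ^ (r + 1) := pow_le_pow_left₀ hk0.le h3 _
      have h5 : (0 : ℝ) ≤ (2 * A) ^ (r + 1) := by positivity
      linarith
    calc (hGraph G k : ℝ) ≤ (n : ℝ) ^ 2 := h1
      _ = (k : ℝ) ^ (r + 1) * ((n : ℝ) ^ 2 / (k : ℝ) ^ (r + 1)) := by field_simp
      _ ≤ _ := mul_le_mul_of_nonneg_right h2 (by positivity)
  · set j := Nat.log 2 (k / A) with hj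
    have hdiv : k / A ≠ 0 := (Nat.div_pos hkA hA).ne'
    have hle : A * 2 ^ j ≤ k := by
      have h1 : 2 ^ j ≤ k / A := Nat.pow_log_le_self 2 hdiv
      exact (Nat.mul_le_mul_left A h1).trans (Nat.mul_div_le k A)
    have hlt : k < 2 * A * 2 ^ j := by
      have h1 : k / A < 2 ^ (j + 1) := Nat.lt_pow_succ_log_self one_lt_two _
      rw [Nat.div_lt_iff_lt_mul hA] at h1
      calc k < 2 ^ (j + 1) * A := h1
        _ = _ := by ring
    refine (hGraph_le_of_splits ((hsplit G hG j univ).of_le hle le_rfl)).trans ?_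
    rw [card_univ, Fintype.card_fin]
    have h2 : (k : ℝ) ^ (r + 1) ≤ (2 * A) ^ (r + 1) * (2 ^ j) ^ (r + 1) := by
      rw [← mul_pow]
      exact pow_le_pow_left₀ hk0.le (by exact_mod_cast hlt.le) _
    rw [← mul_div_assoc, div_le_div_iff₀ (by positivity) (by positivity)]
    calc 8 * (n : ℝ) ^ 2 * (k : ℝ) ^ (r + 1)
        ≤ 8 * (n : ℝ) ^ 2 * ((2 * A) ^ (r + 1) * (2 ^ j) ^ (r + 1)) :=
          mul_le_mul_of_nonneg_left h2 (by positivity)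
      _ = _ := by ring

end Deletion

/-! ### Edges on short odd cycles -/

section ShortCycles

open scoped Classical

variable {V : Type*}

/-- The graph formed by the edges of `G` that lie on a cycle of length `2l + 1` of `G`. -/
def oddCycleEdges (G : SimpleGraph V) (l : ℕ) : SimpleGraph V where
  Adj u v := G.Adj u v ∧ ∃ p : G.Walk v u, p.IsPath ∧ p.length = 2 * l
  symm := ⟨fun _ _ ⟨h, p, hp, hl⟩ => ⟨h.symm, p.reverse, hp.reverse, by simpa using hl⟩⟩
  loopless := ⟨fun _ h => h.1.ne rfl⟩

/-- If the degrees have a large sum of squares, then counting the pairs of neighbors of a vertex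
with fewer than `t` common neighbors gives a vertex `y` with a neighborhood in which such pairs
are rare. After discarding the neighbors lying in many of them, each remaining one has at least
`t` partners with which it has at least `t` common neighbors. -/
theorem exists_rich_neighbors [Fintype V] (H : SimpleGraph V) (t : ℕ)
    (h : (4 * t + 8) * ((t + 1) * Fintype.card V ^ 2) < ∑ y, #{x | H.Adj y x} ^ 2) :
    ∃ (y : V) (Q : Finset V), Q.Nonempty ∧ (∀ x ∈ Q, H.Adj y x) ∧
      ∀ x ∈ Q, t ≤ #{x' ∈ Q | x' ≠ x ∧ t ≤ #{z | H.Adj x z ∧ H.Adj x' z}} := by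
  set N : V → Finset V := fun y => {x | H.Adj y x} with hN
  set poor : V → V → Prop :=
    fun x x' => x' = x ∨ #{z | H.Adj x z ∧ H.Adj x' z} < t with hpoor
  set P : V → ℕ := fun y => ∑ x ∈ N y, #{x' ∈ N y | poor x x'} with hP
  have hpair : ∀ x x' : V, (∑ y, if (H.Adj y x ∧ H.Adj y x') ∧ poor x x' then 1 else 0)
      ≤ t + if x' = x then Fintype.card V else 0 := by
    intro x x'
    rw [← card_filter]
    by_cases hxx : x' = x
    · rw [if_pos hxx]
      exact (card_le_univ _).trans (Nat.le_add_left _ _)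
    · rw [if_neg hxx, add_zero]
      by_cases hp : poor x x'
      · have h1 := hp.resolve_left hxx
        refine (card_le_card fun y hy => ?_).trans h1.le
        obtain ⟨-, hy, -⟩ := mem_filter.mp hy
        exact mem_filter.mpr ⟨mem_univ y, hy.1.symm, hy.2.symm⟩
      · rw [filter_false_of_mem fun y _ hy => hp hy.2, card_empty]
        exact Nat.zero_le t
  have hPsum : ∑ y, P y ≤ (t + 1) * Fintype.card V ^ 2 := by
    have h1 : ∀ y, P y
        = ∑ x, ∑ x', if (H.Adj y x ∧ H.Adj y x') ∧ poor x x' then 1 else 0 := by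
      intro y
      simp only [hP, hN, card_filter, sum_filter]
      refine sum_congr rfl fun x _ => ?_
      by_cases hx : H.Adj y x
      · rw [if_pos hx]
        refine sum_congr rfl fun x' _ => ?_
        by_cases hx' : H.Adj y x' <;> simp [hx, hx']
      · simp [hx]
    calc ∑ y, P y
        = ∑ x, ∑ x', ∑ y, if (H.Adj y x ∧ H.Adj y x') ∧ poor x x' then 1 else 0 := by
          rw [sum_congr rfl fun y _ => h1 y, sum_comm]
          exact sum_congr rfl fun x _ => sum_comm
      _ ≤ ∑ x : V, ∑ x' : V, (t + if x' = x then Fintype.card V else 0) :=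
          sum_le_sum fun x _ => sum_le_sum fun x' _ => hpair x x'
      _ = (t + 1) * Fintype.card V ^ 2 := by
          simp only [sum_add_distrib, sum_ite_eq', mem_univ, if_true, sum_const, card_univ,
            smul_eq_mul]
          ring
  obtain ⟨y, -, hy⟩ : ∃ y ∈ (univ : Finset V), (4 * t + 8) * P y < #(N y) ^ 2 := by
    refine exists_lt_of_sum_lt (lt_of_le_of_lt ?_ h)
    rw [← mul_sum]
    exact Nat.mul_le_mul_left _ hPsum
  have hdiag : #(N y) ≤ P y := by
    rw [card_eq_sum_ones]
    exact sum_le_sum fun x hx => card_pos.mpr ⟨x, mem_filter.mpr ⟨hx, Or.inl rfl⟩⟩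
  have hd : 4 * t + 8 < #(N y) := by
    have h1 : (4 * t + 8) * #(N y) < #(N y) * #(N y) := by
      rw [← sq]; exact (Nat.mul_le_mul_left _ hdiag).trans_lt hy
    exact lt_of_mul_lt_mul_right h1 (Nat.zero_le _)
  set Q : Finset V := {x ∈ N y | 2 * #{x' ∈ N y | poor x x'} ≤ #(N y)} with hQ
  have hQN : Q ⊆ N y := filter_subset _ _
  have hbad : 4 * #(N y \ Q) < #(N y) := by
    have h1 : #(N y \ Q) * #(N y) ≤ 2 * P y := by
      rw [hP, mul_sum, ← smul_eq_mul]
      refine (card_nsmul_le_sum (N y \ Q) (fun x => 2 * #{x' ∈ N y | poor x x'}) _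
        fun x hx => ?_).trans (sum_le_sum_of_subset sdiff_subset)
      obtain ⟨hx, hxQ⟩ := mem_sdiff.mp hx
      by_contra hlt
      exact hxQ (mem_filter.mpr ⟨hx, (not_le.mp hlt).le⟩)
    have h2 : 4 * #(N y \ Q) * #(N y) < #(N y) * #(N y) := by nlinarith
    exact lt_of_mul_lt_mul_right h2 (Nat.zero_le _)
  have hsplit : #(N y \ Q) + #Q = #(N y) := card_sdiff_add_card_eq_card hQN
  refine ⟨y, Q, card_pos.mp (by omega), fun x hx => (mem_filter.mp (hQN hx)).2,
    fun x hx => ?_⟩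
  have hx2 := (mem_filter.mp hx).2
  have hcover : N y ⊆ (N y \ Q) ∪ {x' ∈ N y | poor x x'} ∪
      {x' ∈ Q | x' ≠ x ∧ t ≤ #{z | H.Adj x z ∧ H.Adj x' z}} := by
    intro x' hx'
    by_cases h1 : x' ∈ Q
    · by_cases h2 : poor x x'
      · exact mem_union_left _ (mem_union_right _ (mem_filter.mpr ⟨hx', h2⟩))
      · refine mem_union_right _ (mem_filter.mpr ⟨h1, fun h => h2 (Or.inl h), ?_⟩)
        by_contra h3
        exact h2 (Or.inr (not_le.mp h3))
    · exact mem_union_left _ (mem_union_left _ (mem_sdiff.mpr ⟨hx', h1⟩))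
  have hc := (card_le_card hcover).trans
    ((card_union_le _ _).trans (Nat.add_le_add_right (card_union_le _ _) _))
  omega

/-- The constant in the bound for the number of edges on short odd cycles: that of
`exists_rich_neighbors` for `t = 2r + 2`, as the vertices to be avoided in lengthening a cycle are
fewer than that. -/
def shortCycleConst (r : ℕ) : ℕ := (4 * (2 * r + 2) + 8) * ((2 * r + 2) + 1)

/-- In a graph without `C_{2r+1}`, the edges on cycles `C_{2l+1}` with `l < r` are few: otherwise
one finds among them a vertex `y` and neighbors of it with many common neighbors. An edge `uy`
lies on a cycle `C_{2l+1}`, and its end `u` can be moved along common neighbors, two steps at a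
time and avoiding the cycle, until the cycle has length `2r + 1`. -/
theorem sum_degree_sq_oddCycleEdges_le [Fintype V] {G : SimpleGraph V} {r l : ℕ} (hl : l < r)
    (hG : (SimpleGraph.cycleGraph (2 * r + 1)).Free G) :
    ∑ y, #{x | (oddCycleEdges G l).Adj y x} ^ 2 ≤ shortCycleConst r * Fintype.card V ^ 2 := by
  by_contra! hcon
  rw [shortCycleConst, mul_assoc] at hcon
  obtain ⟨y, Q, ⟨u, hu⟩, hQ, hrich⟩ := exists_rich_neighbors _ _ hcon
  have key : ∀ j ≤ r - l, ∃ x ∈ Q, ∃ W : G.Walk x y, W.IsPath ∧ W.length = 2 * l + 2 * j := by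
    intro j
    induction j with
    | zero =>
      intro _
      obtain ⟨-, W, hW, hlen⟩ := hQ u hu
      exact ⟨u, hu, W, hW, hlen⟩
    | succ j ih =>
      intro hj
      obtain ⟨x, hx, W, hW, hlen⟩ := ih (by omega)
      have hsup : #W.support.toFinset ≤ 2 * l + 2 * j + 1 :=
        (List.toFinset_card_le _).trans (by rw [SimpleGraph.Walk.length_support, hlen])
      obtain ⟨x', hx', hx'W⟩ := exists_mem_notMem_of_card_lt_card
        (lt_of_lt_of_le (hsup.trans_lt (by omega)) (hrich x hx))
      obtain ⟨hx'Q, -, hcommon⟩ := mem_filter.mp hx'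
      have hsup' : #(insert x' W.support.toFinset) ≤ 2 * l + 2 * j + 2 :=
        (card_insert_le _ _).trans (by omega)
      obtain ⟨z, hz, hzW⟩ := exists_mem_notMem_of_card_lt_card
        (lt_of_lt_of_le (hsup'.trans_lt (by omega)) hcommon)
      obtain ⟨-, hxz, hx'z⟩ := mem_filter.mp hz
      rw [mem_insert, List.mem_toFinset, not_or] at hzW
      rw [List.mem_toFinset] at hx'W
      refine ⟨x', hx'Q, .cons hx'z.1 (.cons hxz.1.symm W), ?_, ?_⟩
      · rw [SimpleGraph.Walk.cons_isPath_iff, SimpleGraph.Walk.cons_isPath_iff,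
          SimpleGraph.Walk.support_cons, List.mem_cons, not_or]
        exact ⟨⟨hW, hzW.2⟩, Ne.symm hzW.1, hx'W⟩
      · rw [SimpleGraph.Walk.length_cons, SimpleGraph.Walk.length_cons, hlen]
        omega
  obtain ⟨x, hx, W, hW, hlen⟩ := key (r - l) le_rfl
  have := cycleGraph_isContained_of_isPath W hW (by omega) (hQ x hx).1
  rw [show W.length + 1 = 2 * r + 1 by omega] at this
  exact hG this

theorem card_edgeFinset_oddCycleEdges_le {n : ℕ} {G : SimpleGraph (Fin n)} {r l : ℕ} (hl : l < r)
    (hG : (SimpleGraph.cycleGraph (2 * r + 1)).Free G) :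
    (#(oddCycleEdges G l).edgeFinset : ℝ) ≤ shortCycleConst r * (n : ℝ) ^ (3 / 2 : ℝ) := by
  set H := oddCycleEdges G l with hH
  have h1 : (adjPairs H univ) ^ 2 ≤ shortCycleConst r * n ^ 3 := by
    have h2 := sq_sum_le_card_mul_sum_sq (s := (univ : Finset (Fin n)))
      (f := fun y => #{x | H.Adj y x})
    have h3 := sum_degree_sq_oddCycleEdges_le hl hG
    rw [Fintype.card_fin] at h3
    rw [card_univ, Fintype.card_fin] at h2
    calc (adjPairs H univ) ^ 2 ≤ n * ∑ y, #{x | H.Adj y x} ^ 2 := h2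
      _ ≤ n * (shortCycleConst r * n ^ 2) := Nat.mul_le_mul_left n h3
      _ = _ := by ring
  have h2 : ((n : ℝ) ^ (3 / 2 : ℝ)) ^ 2 = (n : ℝ) ^ 3 := by
    rw [← Real.rpow_natCast, ← Real.rpow_mul (Nat.cast_nonneg n), ← Real.rpow_natCast]
    norm_num
  have hK : (1 : ℝ) ≤ shortCycleConst r := by
    have : 0 < shortCycleConst r := by rw [shortCycleConst]; positivity
    exact_mod_cast this
  have h3 : (adjPairs H univ : ℝ) ^ 2 ≤ (shortCycleConst r * (n : ℝ) ^ (3 / 2 : ℝ)) ^ 2 := by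
    rw [mul_pow, h2]
    calc (adjPairs H univ : ℝ) ^ 2 ≤ shortCycleConst r * (n : ℝ) ^ 3 := by exact_mod_cast h1
      _ ≤ (shortCycleConst r : ℝ) ^ 2 * (n : ℝ) ^ 3 :=
        mul_le_mul_of_nonneg_right (by nlinarith) (by positivity)
  exact (Nat.cast_le.mpr (card_edgeFinset_le_adjPairs H)).trans
    (le_of_sq_le_sq h3 (by positivity))

/-- Deleting all edges on cycles `C_{2l+1}`, `l < r`, makes a graph without `C_{2r+1}` free of
all odd cycles of length at most `2r + 1`. -/
theorem exists_familyFree_hGraph_le {n r k : ℕ} (hk : 1 ≤ k) {G : SimpleGraph (Fin n)}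
    (hG : (SimpleGraph.cycleGraph (2 * r + 1)).Free G) :
    ∃ G' : SimpleGraph (Fin n), FamilyFree (oddCyclesUpTo r) G' ∧
      (hGraph G k : ℝ) ≤ hGraph G' k + r * shortCycleConst r * (n : ℝ) ^ (3 / 2 : ℝ) := by
  set E : Finset (Sym2 (Fin n)) := (range r).biUnion fun l => (oddCycleEdges G l).edgeFinset
    with hE
  refine ⟨G.deleteEdges E, ?_, ?_⟩
  · rintro F ⟨i, hi, hir, rfl⟩ hcon
    rcases hir.eq_or_lt with rfl | hir
    · exact hG (hcon.trans (SimpleGraph.IsContained.of_le (G.deleteEdges_le _)))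
    · obtain ⟨v, p, hp, hlen⟩ := (SimpleGraph.cycleGraph_isContained_iff (by omega)).mp hcon
      cases p with
      | nil => simp at hlen
      | cons h q =>
        rw [SimpleGraph.Walk.cons_isCycle_iff] at hp
        rw [SimpleGraph.deleteEdges_adj] at h
        refine h.2 (mem_coe.mpr (mem_biUnion.mpr ⟨i, mem_range.mpr hir, ?_⟩))
        rw [SimpleGraph.mem_edgeFinset, SimpleGraph.mem_edgeSet]
        refine ⟨h.1, q.mapLe (G.deleteEdges_le _), hp.1.mapLe _, ?_⟩
        rw [SimpleGraph.Walk.length_cons] at hlen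
        simpa using hlen
  · obtain ⟨s, hs, hcol, hcard⟩ := (hGraph_isLeast (G.deleteEdges (E : Set (Sym2 (Fin n)))) hk).1
    have hEG : (E : Set (Sym2 (Fin n))) ⊆ G.edgeSet := by
      intro e he
      obtain ⟨l, -, he⟩ := mem_biUnion.mp (mem_coe.mp he)
      exact SimpleGraph.edgeSet_mono (show oddCycleEdges G l ≤ G from fun _ _ h => h.1)
        (SimpleGraph.mem_edgeFinset.mp he)
    have h1 : hGraph G k ≤ #(E ∪ s) := by
      refine hGraph_le_of_colorable _ ?_ ?_
      · rw [coe_union]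
        exact Set.union_subset hEG
          (hs.trans (SimpleGraph.edgeSet_mono (G.deleteEdges_le _)))
      · rwa [coe_union, ← SimpleGraph.deleteEdges_deleteEdges]
    have h2 : (#E : ℝ) ≤ r * shortCycleConst r * (n : ℝ) ^ (3 / 2 : ℝ) := by
      calc (#E : ℝ) ≤ ∑ l ∈ range r, (#(oddCycleEdges G l).edgeFinset : ℝ) := by
            exact_mod_cast card_biUnion_le
        _ ≤ ∑ l ∈ range r, shortCycleConst r * (n : ℝ) ^ (3 / 2 : ℝ) :=
            sum_le_sum fun l hl => card_edgeFinset_oddCycleEdges_le (mem_range.mp hl) hG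
        _ = _ := by rw [sum_const, card_range, nsmul_eq_mul, mul_assoc]
    have h3 : (hGraph G k : ℝ) ≤ #E + #s := by exact_mod_cast h1.trans (card_union_le _ _)
    rw [hcard] at h3
    linarith

end ShortCycles

/-! ### The maxima over all graphs -/

theorem familyFree_singleCycle {V : Type*} {G : SimpleGraph V} {ℓ : ℕ} :
    FamilyFree (singleCycle ℓ) G ↔ (SimpleGraph.cycleGraph ℓ).Free G :=
  ⟨fun h => h _ rfl, by rintro h F rfl; exact h⟩

theorem FamilyFree.singleCycle {V : Type*} {G : SimpleGraph V} {r : ℕ} (hr : 1 ≤ r)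
    (h : FamilyFree (oddCyclesUpTo r) G) : FamilyFree (singleCycle (2 * r + 1)) G :=
  familyFree_singleCycle.mpr (h _ ⟨r, hr, le_rfl, rfl⟩)

theorem familyFree_oddCyclesUpTo_bot (V : Type*) (r : ℕ) :
    FamilyFree (oddCyclesUpTo r) (⊥ : SimpleGraph V) := by
  rintro F ⟨i, hi, -, rfl⟩ hcon
  obtain ⟨v, p, hp, -⟩ := (SimpleGraph.cycleGraph_isContained_iff (by omega)).mp hcon
  exact SimpleGraph.isAcyclic_bot p hp

end EdgeDeletion

theorem theoremt (r : ℕ) (hr : 1 ≤ r) :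
    ∃ c : ℝ, 0 < c ∧ ∀ n k : ℕ, 1 ≤ k → k ≤ n →
      |(EdgeDeletion.hMax n k (EdgeDeletion.singleCycle (2 * r + 1)) : ℝ)
          - (EdgeDeletion.hMax n k (EdgeDeletion.oddCyclesUpTo r) : ℝ)|
        ≤ c * (n : ℝ) ^ (3 / 2 : ℝ) ∧
      (EdgeDeletion.hMax n k (EdgeDeletion.singleCycle (2 * r + 1)) : ℝ)
        ≤ c * ((n : ℝ) ^ 2 / (k : ℝ) ^ (r + 1)) := by
  obtain ⟨c, hc, hbound⟩ := EdgeDeletion.exists_hGraph_le hr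
  have hK : (0 : ℝ) ≤ r * EdgeDeletion.shortCycleConst r := by positivity
  refine ⟨c + r * EdgeDeletion.shortCycleConst r, by linarith, fun n k hk _ => ?_⟩
  have hbot := EdgeDeletion.familyFree_oddCyclesUpTo_bot (Fin n) r
  obtain ⟨⟨G, hG, hGk⟩, hmax⟩ := EdgeDeletion.hMax_isGreatest n k
    (EdgeDeletion.singleCycle (2 * r + 1)) ⟨⊥, hbot.singleCycle hr⟩
  obtain ⟨⟨G₁, hG₁, hG₁k⟩, hmax₁⟩ := EdgeDeletion.hMax_isGreatest n k
    (EdgeDeletion.oddCyclesUpTo r) ⟨⊥, hbot⟩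
  have hGfree := EdgeDeletion.familyFree_singleCycle.mp hG
  constructor
  · obtain ⟨G', hG', hle⟩ := EdgeDeletion.exists_familyFree_hGraph_le hk hGfree
    have h1 : (EdgeDeletion.hMax n k (EdgeDeletion.oddCyclesUpTo r) : ℝ)
        ≤ EdgeDeletion.hMax n k (EdgeDeletion.singleCycle (2 * r + 1)) :=
      Nat.cast_le.mpr (hmax ⟨G₁, hG₁.singleCycle hr, hG₁k⟩)
    have h2 : (EdgeDeletion.hGraph G' k : ℝ)
        ≤ EdgeDeletion.hMax n k (EdgeDeletion.oddCyclesUpTo r) :=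
      Nat.cast_le.mpr (hmax₁ ⟨G', hG', rfl⟩)
    have h3 : (0 : ℝ) ≤ c * (n : ℝ) ^ (3 / 2 : ℝ) := by positivity
    rw [abs_of_nonneg (sub_nonneg.mpr h1), ← hGk, add_mul]
    linarith
  · rw [← hGk, add_mul]
    exact (hbound n k G hk hGfree).trans (le_add_of_nonneg_right (by positivity))
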